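/- Let $n\ge 2$, let $H=\{x\in\mathbb R^{n+1}:\sum_i x_i=0\}$ be the $n$-dimensional Euclidean space with the inner product of $\mathbb R^{n+1}$, let $p_H:\mathbb R^{n+1}\to H$ be the orthogonal projection, let $A_n=\mathbb Z^{n+1}\cap H$, and let $A_n^\#=\{y\in H:\langle x,y\rangle\in\mathbb Z\ \text{for all } x\in A_n\}$. Let $\mathcal P=\{z\in H:\langle z,z\rangle\le\langle z-x,z-x\rangle\ \text{for all } x\in A_n\}$ be the Voronoi region of $A_n$, let $V_{\mathcal P}$ be its set of vertices, and let $\|x\|_{\mathcal P}=\inf\{\lambda\ge 0: x\in\lambda\mathcal P\}$. For a norm $\|\cdot\|$ on $\mathbb R^n$ let $$m_1(\mathbb R^n,\|\cdot\|)=\sup_S\ \limsup_{R\to\infty}\frac{\operatorname{Vol}(S\cap[-R,R]^n)}{\operatorname{Vol}([-R,R]^n)},$$ where $S$ runs over the Lebesgue measurable subsets of $\mathbb R^n$ such that $\|x-y\|\ne 1$ for all $x,y\in S$. Let $\tilde G$ be the Cayley graph on $\frac12A_n^\#$ with generating set $\frac12V_{\mathcal P}$, and let $\tilde d$ be its graph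 distance. A clique of $\tilde G$ is a set of pairwise adjacent vertices. For a set $C$ of vertices, $N[C]$ denotes the set of all vertices that lie in $C$ or are adjacent to a vertex in $C$. Let $V_0=\{0,1\}^{n+1}\setminus\{(0,\dots,0),(1,\dots,1)\}$, and call $\{i:u_i=1\}$ the support of $u\in V_0$. Then: 1. $m_1(\mathbb R^n,\|\cdot\|_{\mathcal P})=\dfrac1{2^n}$, where $\mathbb R^n$ is identified with $H$ by an arbitrary linear isomorphism. 2. $V_{\mathcal P}=\{p_H(u):u\in V_0\}$, and $\frac12V_{\mathcal P}$ generates the group $\frac12A_n^\#$. 3. (Property D) If $x,y\in\frac12A_n^\#$ and $\tilde d(x,y)=2$, then $\|x-y\|_{\mathcal P}=1$. 4. A set $C\subset\frac12A_n^\#$ with $0\in C$ is a clique of $\tilde G$ if and only if $C=\{0,\frac12p_H(u_1),\dots,\frac12p_H(u_s)\}$ for some $s\ge0$ and $u_1,\dots,u_s\in V_0$ whose supports satisfy $I_1\subsetneq I_2\subsetneq\dots\subsetneq I_s$. 5. Every clique $C$ of $\tilde G$ has at most $n+1$ vertices, $N[C]$ is finite, and, if $C$ is non-empty, $\dfrac{|C|}{|N[C]|}\le\dfrac1{2^n}$.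 -/

import Mathlib

open Set Filter MeasureTheory
open scoped ENNReal Pointwise

noncomputable section

/-! ### Sets avoiding distance one, their density, and the number `m₁` -/

/-- The upper density of `A ⊆ ℝⁿ`:
`limsup_{R → ∞} Vol (A ∩ [-R, R]ⁿ) / Vol ([-R, R]ⁿ)`. -/
def upperDensity {n : ℕ} (A : Set (Fin n → ℝ)) : ℝ≥0∞ :=
  limsup (fun R : ℝ =>
    volume (A ∩ Icc (fun _ => -R) (fun _ => R)) /
      volume (Icc (fun _ => -R) (fun _ => R) : Set (Fin n → ℝ))) atTop

/-- `S` avoids distance `1` for the norm `N`. -/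
def AvoidsOne {E : Type*} [AddGroup E] (N : E → ℝ) (S : Set E) : Prop :=
  ∀ x ∈ S, ∀ y ∈ S, N (x - y) ≠ 1

/-- `m₁(ℝⁿ, N)`: the supremum of the densities of the Lebesgue measurable sets that avoid
distance `1` for the norm `N`. -/
def mOne {n : ℕ} (N : (Fin n → ℝ) → ℝ) : ℝ≥0∞ :=
  ⨆ (S : Set (Fin n → ℝ)) (_ : NullMeasurableSet S volume) (_ : AvoidsOne N S), upperDensity S

/-- The norm with unit ball `P`, `‖x‖_P = inf {r | x ∈ r P}`. -/
def polytopeNorm {E : Type*} [AddCommGroup E] [Module ℝ E] (P : Set E) (x : E) : ℝ :=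
  gauge P x

/-! ### Lattices in a Euclidean space -/

section Lattice

variable {E : Type*} [NormedAddCommGroup E] [InnerProductSpace ℝ E]

/-- The Voronoi region of `L`: the points at least as close to `0` as to any point of `L`. -/
def voronoiRegion (L : AddSubgroup E) : Set E :=
  {z | ∀ x ∈ L, inner ℝ z z ≤ inner ℝ (z - x) (z - x)}

/-- The dual lattice `L^#`. -/
def dualLattice (L : AddSubgroup E) : AddSubgroup E where
  carrier := {y | ∀ x ∈ L, ∃ k : ℤ, inner ℝ x y = k}
  zero_mem' := fun x _ => ⟨0, by simp⟩
  add_mem' := by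
    intro a b ha hb x hx
    obtain ⟨k, hk⟩ := ha x hx
    obtain ⟨l, hl⟩ := hb x hx
    exact ⟨k + l, by rw [inner_add_right, hk, hl]; push_cast; rfl⟩
  neg_mem' := by
    intro a ha x hx
    obtain ⟨k, hk⟩ := ha x hx
    exact ⟨-k, by rw [inner_neg_right, hk]; push_cast; rfl⟩

end Lattice

/-! ### The lattice `A_n` -/

/-- The hyperplane `H = {x ∈ ℝⁿ⁺¹ | ∑ xᵢ = 0}`, an `n`-dimensional Euclidean space. -/
def hyperplaneH (n : ℕ) : Submodule ℝ (EuclideanSpace ℝ (Fin (n + 1))) where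
  carrier := {x | ∑ i, x i = 0}
  zero_mem' := by simp
  add_mem' := by
    intro a b ha hb
    simp only [mem_ofPred_eq, PiLp.add_apply, Finset.sum_add_distrib] at *
    rw [ha, hb, add_zero]
  smul_mem' := by
    intro c a ha
    simp only [mem_ofPred_eq, PiLp.smul_apply, smul_eq_mul, ← Finset.mul_sum] at *
    rw [ha, mul_zero]

/-- The root lattice `A_n = ℤⁿ⁺¹ ∩ H`, inside `H`. -/
def latticeA (n : ℕ) : AddSubgroup (hyperplaneH n) where
  carrier := {x | ∀ i, ∃ k : ℤ, (x : EuclideanSpace ℝ (Fin (n + 1))) i = k}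
  zero_mem' := fun _ => ⟨0, by simp⟩
  add_mem' := by
    intro a b ha hb i
    obtain ⟨k, hk⟩ := ha i
    obtain ⟨l, hl⟩ := hb i
    exact ⟨k + l, by simp [hk, hl]⟩
  neg_mem' := by
    intro a ha i
    obtain ⟨k, hk⟩ := ha i
    exact ⟨-k, by simp [hk]⟩

/-- The Voronoi region `P` of `A_n`, a polytope in `H`. -/
def regionP (n : ℕ) : Set (hyperplaneH n) :=
  voronoiRegion (latticeA n)

/-- The vertices (extreme points) of `P`. -/
def verticesP (n : ℕ) : Set (hyperplaneH n) :=
  (regionP n).extremePoints ℝ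

/-- The orthogonal projection `p_H : ℝⁿ⁺¹ → H`. -/
def projH (n : ℕ) (u : EuclideanSpace ℝ (Fin (n + 1))) : hyperplaneH n :=
  (hyperplaneH n).orthogonalProjectionOnto u

/-- `V₀ = {0,1}ⁿ⁺¹ \ {(0,…,0), (1,…,1)}`. -/
def cubeV₀ (n : ℕ) : Set (EuclideanSpace ℝ (Fin (n + 1))) :=
  {u | (∀ i, u i = 0 ∨ u i = 1) ∧ (∃ i, u i ≠ 0) ∧ ∃ i, u i ≠ 1}

/-- The support `{i | uᵢ = 1}` of a `0`-`1` vector. -/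
def cubeSupport {n : ℕ} (u : EuclideanSpace ℝ (Fin (n + 1))) : Set (Fin (n + 1)) :=
  {i | u i = 1}

/-- The group `½ A_n^#`. -/
def halfDual (n : ℕ) : AddSubgroup (hyperplaneH n) :=
  (1 / 2 : ℝ) • dualLattice (latticeA n)

/-- The Cayley graph on `½ A_n^#` with generating set `½ V_P`, where `V_P` is the set of
vertices of `P`. -/
def cayleyG (n : ℕ) : SimpleGraph (halfDual n) :=
  SimpleGraph.addCayley {g | (g : hyperplaneH n) ∈ (1 / 2 : ℝ) • verticesP n}

/-! ### Closed neighbourhoods and local density -/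

/-- The closed neighbourhood `N[A]` of a set of vertices. -/
def closedNbhd {V : Type*} (G : SimpleGraph V) (A : Set V) : Set V :=
  {v | ∃ a ∈ A, v = a ∨ G.Adj a v}

/-- The local density `|C| / |N[C]|` (for `C` and `N[C]` finite). -/
def localDensity {V : Type*} (G : SimpleGraph V) (C : Set V) : ℝ :=
  (C.ncard : ℝ) / ((closedNbhd G C).ncard : ℝ)

end

/-!
In coordinates, the Voronoi region `P` of `A_n` is the set of `z ∈ H` with `z_i - z_j ≤ 1` for all
`i, j` (`mem_regionP_iff`), so `‖z‖_P` is the spread `max z_i - min z_i`. The group `½ A_n^#`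
consists of the points of `H` whose coordinate differences are halves of integers, and its points
of norm at most `½` are the half vertices `½ p_H(1_J)`, including `0` (`exists_eq_halfVertex`). Hence
adjacency in the Cayley graph means being at norm distance `½`, and Property D follows. The difference of the half vertices of `J`
and `K` has norm one as soon as `J` and `K` are incomparable; this is why cliques are chains.

Both density bounds come from one argument, which applies to any set `S ⊆ H` avoiding distance one.
For `s ∈ S`, the non-empty `J` with `s + ½ p_H(1_J) ∈ S` form a chain, so they have a common element
`i`, a *pivot* of `S` at `s` (`exists_isPivot`). Let `s` claim the `2ⁿ` points `s + ½ p_H(1_J)` with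
`i ∉ J`. No point is claimed twice (`IsPivot.eq_and_eq`): if `s + ½ p_H(1_J) = t + ½ p_H(1_K)`, then
`J` and `K` are comparable, say `K ⊆ J`, and `t = s + ½ p_H(1_{J \ K})` forces `J = K`, since the
pivot of `s` is not in `J`. For a clique `C`, the claimed points lie in `N[C]`, so
`2ⁿ |C| ≤ |N[C]|`. For a measurable set avoiding distance one, the points with a given pivot form a
measurable set, so the part of the set in a cube has `2ⁿ` disjoint copies in a slightly larger cube
(`two_pow_mul_volume_le`), and the density is at most `1 / 2ⁿ`.

The bound on `m₁` is attained by the union of the translates by `A_n` of a half-open version of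
`½ P` (`tileSet`). Because `½ P` tiles along `½ A_n`, and `A_n` has index `2ⁿ` in `½ A_n`, this set has
`2ⁿ` translates that cover the space; the covering is an explicit rounding to integer vectors with sum
zero (`exists_int_sum_eq_zero_sub_le`).
-/

/-! ### Points of `H` and their coordinate differences -/

/-- A point of `H` is determined by its coordinate differences. -/
lemma hyperplaneH_ext_sub {n : ℕ} {x y : hyperplaneH n} (j : Fin (n + 1))
    (h : ∀ i, x.1 i - x.1 j = y.1 i - y.1 j) : x = y := by
  have hx : ∑ i, x.1 i = 0 := x.2
  have hy : ∑ i, y.1 i = 0 := y.2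
  have hs : ∑ i, (x.1 i - x.1 j) = ∑ i, (y.1 i - y.1 j) := Finset.sum_congr rfl fun i _ => h i
  simp only [Finset.sum_sub_distrib, hx, hy, Finset.sum_const, Finset.card_univ, Fintype.card_fin,
    zero_sub, neg_inj, nsmul_eq_mul] at hs
  have hj : x.1 j = y.1 j := mul_left_cancel₀ (by positivity) hs
  ext i
  linarith [h i]

/-- The root `e_i - e_j`. -/
noncomputable def root {n : ℕ} (i j : Fin (n + 1)) : hyperplaneH n :=
  ⟨EuclideanSpace.single i 1 - EuclideanSpace.single j 1, by
    change ∑ k, _ = (0 : ℝ)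
    simp [Finset.sum_sub_distrib]⟩

lemma root_mem {n : ℕ} (i j : Fin (n + 1)) : root i j ∈ latticeA n := by
  intro k
  refine ⟨(if k = i then 1 else 0) - (if k = j then 1 else 0), ?_⟩
  simp [root]

lemma inner_root {n : ℕ} (i j : Fin (n + 1)) (x : hyperplaneH n) :
    inner ℝ (root i j) x = x.1 i - x.1 j := by
  simp [root, Submodule.coe_inner, inner_sub_left, EuclideanSpace.inner_single_left]

lemma inner_hyperplaneH {n : ℕ} (x y : hyperplaneH n) : inner ℝ x y = ∑ i, x.1 i * y.1 i := by
  simp [Submodule.coe_inner, PiLp.inner_apply, mul_comm]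

/-- Projecting to `H` subtracts a multiple of `(1, …, 1)`, hence preserves coordinate
differences. -/
lemma projH_sub {n : ℕ} (u : EuclideanSpace ℝ (Fin (n + 1))) (i j : Fin (n + 1)) :
    (projH n u).1 i - (projH n u).1 j = u i - u j := by
  rw [← inner_root, projH, Submodule.inner_orthogonalProjectionOnto_eq_of_mem_left]
  simp [root, inner_sub_left, EuclideanSpace.inner_single_left]

/-- Since `H` is orthogonal to `(1, …, 1)`, the inner product with a point of `H` does not change
when a constant is subtracted from all coordinates of the other argument. -/
lemma inner_eq_sum_sub {n : ℕ} (x y : hyperplaneH n) (c : ℝ) :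
    inner ℝ x y = ∑ i, x.1 i * (y.1 i - c) := by
  have hx : ∑ i, x.1 i = 0 := x.2
  rw [inner_hyperplaneH]
  simp [mul_sub, Finset.sum_sub_distrib, ← Finset.sum_mul, hx]

lemma exists_coord_le {n : ℕ} (x : hyperplaneH n) : ∃ j, ∀ i, x.1 j ≤ x.1 i :=
  Finite.exists_min _

/-! ### The Voronoi region and its norm -/

/-- The Voronoi relevant vectors of `A_n` are its roots. -/
lemma mem_regionP_iff {n : ℕ} {z : hyperplaneH n} :
    z ∈ regionP n ↔ ∀ i j, z.1 i - z.1 j ≤ 1 := by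
  have key (x : hyperplaneH n) : inner ℝ (z - x) (z - x) =
      inner ℝ z z - 2 * inner ℝ x z + inner ℝ x x := by
    rw [inner_sub_sub_self, real_inner_comm x z]; ring
  constructor
  · intro h i j
    rcases eq_or_ne i j with rfl | hij
    · simp
    have h1 := h _ (root_mem i j)
    have h2 : inner ℝ (root i j) (root i j) = (2 : ℝ) := by
      rw [inner_root]; simp [root, hij, hij.symm]; norm_num
    rw [key, inner_root, h2] at h1
    linarith
  · intro h x hx
    obtain ⟨j, hj⟩ := exists_coord_le z
    rw [key, inner_eq_sum_sub x z (z.1 j), inner_eq_sum_sub x x 0]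
    have hs : ∑ i, x.1 i = 0 := x.2
    have : ∑ i, (2 * (x.1 i * (z.1 i - z.1 j)) - x.1 i) ≤ ∑ i, x.1 i * (x.1 i - 0) := by
      refine Finset.sum_le_sum fun i _ => ?_
      obtain ⟨k, hk⟩ := hx i
      have h0 : 0 ≤ z.1 i - z.1 j := sub_nonneg.2 (hj i)
      have h1 := h i j
      -- `|k| ≤ k²` for integers, and `|2 t - 1| ≤ 1` for `t = z_i - z_j ∈ [0, 1]`
      have h2 : |(k : ℝ)| ≤ k * k := by
        have : |k| ≤ k * k := by
          rw [← abs_mul_abs_self k]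
          rcases eq_or_ne k 0 with rfl | hk0
          · simp
          · nlinarith [Int.one_le_abs hk0]
        exact_mod_cast this
      have h3 : |k * (2 * (z.1 i - z.1 j) - 1)| ≤ |(k : ℝ)| := by
        rw [abs_mul]
        exact mul_le_of_le_one_right (abs_nonneg _) (abs_le.2 ⟨by linarith, by linarith⟩)
      rw [hk]
      linarith [le_abs_self (k * (2 * (z.1 i - z.1 j) - 1))]
    rw [Finset.sum_sub_distrib, ← Finset.mul_sum, hs] at this
    linarith

/-- The norm `‖x‖_P` is the spread `max x_i - min x_i`. -/
lemma polytopeNorm_regionP {n : ℕ} {x : hyperplaneH n} {a b : Fin (n + 1)}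
    (h : ∀ i j, x.1 i - x.1 j ≤ x.1 a - x.1 b) :
    polytopeNorm (regionP n) x = x.1 a - x.1 b := by
  have h0 : 0 ≤ x.1 a - x.1 b := by simpa using h a a
  have hset : {r ∈ Ioi (0 : ℝ) | r⁻¹ • x ∈ regionP n} = Ioi 0 ∩ Ici (x.1 a - x.1 b) := by
    ext r
    refine and_congr_right fun (hr : 0 < r) => ?_
    simp only [mem_regionP_iff, Submodule.coe_smul, PiLp.smul_apply, smul_eq_mul, ← mul_sub,
      inv_mul_le_iff₀ hr, mul_one, mem_Ici]
    exact ⟨fun H => H a b, fun H i j => (h i j).trans H⟩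
  rw [polytopeNorm, gauge_def', hset]
  rcases h0.eq_or_lt with h1 | h1
  · rw [← h1, inter_eq_left.2 Ioi_subset_Ici_self, csInf_Ioi]
  · rw [inter_eq_right.2 (Ici_subset_Ioi.2 h1), csInf_Ici]

lemma polytopeNorm_regionP_eq_one_iff {n : ℕ} {x : hyperplaneH n} :
    polytopeNorm (regionP n) x = 1 ↔
      (∀ i j, x.1 i - x.1 j ≤ 1) ∧ ∃ i j, x.1 i - x.1 j = 1 := by
  constructor
  · intro h
    obtain ⟨⟨a, b⟩, hab⟩ := Finite.exists_max fun p : Fin (n + 1) × Fin (n + 1) =>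
      x.1 p.1 - x.1 p.2
    have h1 := polytopeNorm_regionP fun i j => hab (i, j)
    rw [h] at h1
    exact ⟨fun i j => h1 ▸ hab (i, j), a, b, h1.symm⟩
  · rintro ⟨h, a, b, hab⟩
    rw [← hab]
    exact polytopeNorm_regionP fun i j => (h i j).trans hab.ge

/-! ### The half vertices `½ p_H(1_J)` -/

/-- The indicator vector `1_J`. -/
def indicatorVec {n : ℕ} (J : Finset (Fin (n + 1))) : EuclideanSpace ℝ (Fin (n + 1)) :=
  WithLp.toLp 2 fun i => if i ∈ J then 1 else 0

/-- The point `½ p_H(1_J)`; it vanishes when `J` is empty or everything, and is half a vertex of the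
Voronoi region otherwise. -/
noncomputable def halfVertex {n : ℕ} (J : Finset (Fin (n + 1))) : hyperplaneH n :=
  (1 / 2 : ℝ) • projH n (indicatorVec J)

lemma halfVertex_sub {n : ℕ} (J : Finset (Fin (n + 1))) (i j : Fin (n + 1)) :
    (halfVertex J).1 i - (halfVertex J).1 j =
      (if i ∈ J then 1 / 2 else 0) - (if j ∈ J then 1 / 2 else 0) := by
  have := projH_sub (indicatorVec J) i j
  simp only [halfVertex, Submodule.coe_smul, PiLp.smul_apply, smul_eq_mul, ← mul_sub, this]
  simp [indicatorVec, mul_sub]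

lemma halfVertex_empty {n : ℕ} : halfVertex (∅ : Finset (Fin (n + 1))) = 0 :=
  hyperplaneH_ext_sub 0 fun i => by simp [halfVertex_sub]

lemma halfVertex_univ {n : ℕ} : halfVertex (Finset.univ : Finset (Fin (n + 1))) = 0 :=
  hyperplaneH_ext_sub 0 fun i => by simp [halfVertex_sub]

lemma halfVertex_compl {n : ℕ} (J : Finset (Fin (n + 1))) : halfVertex Jᶜ = -halfVertex J :=
  hyperplaneH_ext_sub 0 fun i => by
    have h := halfVertex_sub J i 0
    have h' := halfVertex_sub Jᶜ i 0
    simp only [Submodule.coe_neg, PiLp.neg_apply, Finset.mem_compl] at *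
    split_ifs at * <;> linarith

lemma halfVertex_sdiff {n : ℕ} {J K : Finset (Fin (n + 1))} (h : K ⊆ J) :
    halfVertex (J \ K) = halfVertex J - halfVertex K :=
  hyperplaneH_ext_sub 0 fun i => by
    have h1 := halfVertex_sub J i 0
    have h2 := halfVertex_sub K i 0
    have h3 := halfVertex_sub (J \ K) i 0
    have h4 := @h i
    have h5 := @h 0
    simp only [Submodule.coe_sub, PiLp.sub_apply, Finset.mem_sdiff] at *
    split_ifs at * <;> first | linarith | tauto

lemma halfVertex_ne_zero {n : ℕ} {J : Finset (Fin (n + 1))} (h : J.Nonempty)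
    (h' : J ≠ Finset.univ) : halfVertex J ≠ 0 := by
  obtain ⟨i, hi⟩ := h
  obtain ⟨j, hj⟩ : ∃ j, j ∉ J := by simpa [Finset.eq_univ_iff_forall] using h'
  intro h0
  have := halfVertex_sub J i j
  simp [h0, hi, hj] at this

lemma halfVertex_sub_le {n : ℕ} (J : Finset (Fin (n + 1))) (i j : Fin (n + 1)) :
    (halfVertex J).1 i - (halfVertex J).1 j ≤ 1 / 2 := by
  rw [halfVertex_sub]; split_ifs <;> norm_num

lemma indicatorVec_mem_cubeV₀ {n : ℕ} {J : Finset (Fin (n + 1))} :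
    indicatorVec J ∈ cubeV₀ n ↔ J.Nonempty ∧ J ≠ Finset.univ := by
  have h : ∀ i, indicatorVec J i = 0 ∨ indicatorVec J i = 1 := fun i => by
    simp only [indicatorVec]; split_ifs <;> simp
  simp only [cubeV₀, mem_ofPred_eq, h, implies_true, true_and]
  simp [indicatorVec, Finset.Nonempty, Finset.eq_univ_iff_forall]

lemma cubeSupport_indicatorVec {n : ℕ} (J : Finset (Fin (n + 1))) :
    cubeSupport (indicatorVec J) = J := by
  ext i; simp [cubeSupport, indicatorVec]

lemma exists_eq_indicatorVec {n : ℕ} {u : EuclideanSpace ℝ (Fin (n + 1))} (hu : u ∈ cubeV₀ n) :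
    ∃ J, u = indicatorVec J := by
  classical
  refine ⟨Finset.univ.filter fun i => u i = 1, ?_⟩
  ext i
  rcases hu.1 i with h | h <;> simp [indicatorVec, h]

/-! ### The dual lattice -/

lemma mem_dualLattice_iff {n : ℕ} {y : hyperplaneH n} :
    y ∈ dualLattice (latticeA n) ↔ ∀ i j, ∃ k : ℤ, y.1 i - y.1 j = k := by
  constructor
  · intro h i j
    rw [← inner_root]
    exact h _ (root_mem i j)
  · intro h x hx
    choose k hk using h
    choose l hl using hx
    refine ⟨∑ i, l i * k i 0, ?_⟩
    rw [inner_eq_sum_sub x y (y.1 0)]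
    push_cast
    exact Finset.sum_congr rfl fun i _ => by rw [hl, hk]

lemma mem_halfDual_iff {n : ℕ} {y : hyperplaneH n} :
    y ∈ halfDual n ↔ ∀ i j, ∃ k : ℤ, y.1 i - y.1 j = k / 2 := by
  rw [halfDual, AddSubgroup.mem_smul_pointwise_iff_exists]
  constructor
  · rintro ⟨z, hz, rfl⟩ i j
    obtain ⟨k, hk⟩ := mem_dualLattice_iff.1 hz i j
    refine ⟨k, ?_⟩
    simp only [Submodule.coe_smul, PiLp.smul_apply, smul_eq_mul, ← mul_sub, hk]
    ring
  · intro h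
    refine ⟨(2 : ℝ) • y, mem_dualLattice_iff.2 fun i j => ?_, by rw [smul_smul]; norm_num⟩
    obtain ⟨k, hk⟩ := h i j
    refine ⟨k, ?_⟩
    simp only [Submodule.coe_smul, PiLp.smul_apply, smul_eq_mul, ← mul_sub, hk]
    ring

lemma halfVertex_mem_halfDual {n : ℕ} (J : Finset (Fin (n + 1))) : halfVertex J ∈ halfDual n := by
  refine mem_halfDual_iff.2 fun i j =>
    ⟨(if i ∈ J then 1 else 0) - (if j ∈ J then 1 else 0), ?_⟩
  rw [halfVertex_sub]
  split_ifs <;> norm_num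

/-- The points of `½ A_n^#` of norm at most `½` are the half vertices and `0`. -/
lemma exists_eq_halfVertex {n : ℕ} {d : hyperplaneH n} (hd : d ∈ halfDual n)
    (h : ∀ i j, d.1 i - d.1 j ≤ 1 / 2) : ∃ J ≠ Finset.univ, d = halfVertex J := by
  classical
  obtain ⟨j, hj⟩ := exists_coord_le d
  refine ⟨Finset.univ.filter fun i => d.1 i ≠ d.1 j, fun hu => ?_, ?_⟩
  · simpa using hu.ge (Finset.mem_univ j)
  · refine hyperplaneH_ext_sub j fun i => ?_
    obtain ⟨k, hk⟩ := mem_halfDual_iff.1 hd i j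
    have h1 : 0 ≤ (k : ℝ) := by linarith [hj i]
    have h2 : (k : ℝ) ≤ 1 := by linarith [h i j]
    have h1' : 0 ≤ k := by exact_mod_cast h1
    have h2' : k ≤ 1 := by exact_mod_cast h2
    rw [halfVertex_sub, hk]
    obtain rfl | rfl : k = 0 ∨ k = 1 := by omega
    · have : d.1 i = d.1 j := by simpa [sub_eq_zero] using hk
      simp [this]
    · have : d.1 i ≠ d.1 j := fun h => by norm_num [h] at hk
      simp [this]

/-! ### The vertices of the Voronoi region -/

/-- A convex combination equal to `p_H(1_J)` has all its tight inequalities in common with it, and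
these determine a point of `H`. -/
lemma projH_mem_extremePoints {n : ℕ} {J : Finset (Fin (n + 1))} (h : J.Nonempty)
    (h' : J ≠ Finset.univ) : projH n (indicatorVec J) ∈ verticesP n := by
  have hJ := fun i j => projH_sub (indicatorVec J) i j
  simp only [indicatorVec] at hJ
  refine ⟨mem_regionP_iff.2 fun i j => ?_, ?_⟩
  · rw [projH_sub]; simp only [indicatorVec]; split_ifs <;> norm_num
  obtain ⟨a, ha⟩ := h
  obtain ⟨b, hb⟩ : ∃ j, j ∉ J := by simpa [Finset.eq_univ_iff_forall] using h'
  rintro x hx y hy ⟨s, t, hs, ht, hst, hxy⟩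
  rw [mem_regionP_iff] at hx hy
  -- the inequalities `x_i - x_j ≤ 1`, for `i ∈ J` and `j ∉ J`, are tight
  have key : ∀ i ∈ J, ∀ j ∉ J, x.1 i - x.1 j = 1 := by
    intro i hi j hj
    have e : s * (x.1 i - x.1 j) + t * (y.1 i - y.1 j) = 1 := by
      have := hJ i j
      change (projH n (indicatorVec J)).1 i - (projH n (indicatorVec J)).1 j = _ at this
      rw [← hxy] at this
      simp [hi, hj] at this
      linarith
    nlinarith [hx i j, hy i j, mul_nonneg ht.le (sub_nonneg.2 (hy i j))]
  refine hyperplaneH_ext_sub b fun i => ?_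
  rw [projH_sub]
  simp only [indicatorVec, hb, if_false]
  split_ifs with hi
  · linarith [key i hi b hb]
  · linarith [key a ha b hb, key a ha i hi]

/-- If some coordinate of `z` lies strictly between the minimum and the minimum plus one, then it
can be moved both ways inside the Voronoi region. -/
lemma exists_of_mem_extremePoints {n : ℕ} (hn : n ≠ 0) {z : hyperplaneH n}
    (hz : z ∈ verticesP n) :
    ∃ J : Finset (Fin (n + 1)), J.Nonempty ∧ J ≠ Finset.univ ∧ z = projH n (indicatorVec J) := by
  classical
  obtain ⟨j, hj⟩ := exists_coord_le z
  have hP := mem_regionP_iff.1 hz.1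
  -- moving along `p_H(e_i)` by up to `ε` in both directions stays in `P` only if `ε = 0`
  have move (i : Fin (n + 1)) (ε : ℝ) (hε : 0 ≤ ε) (h1 : ∀ k ≠ i, z.1 i + ε - z.1 k ≤ 1)
      (h2 : ∀ k ≠ i, z.1 k - (z.1 i - ε) ≤ 1) : ε = 0 := by
    obtain ⟨l, hl⟩ : ∃ l, l ≠ i := by
      have : Nontrivial (Fin (n + 1)) := Fin.nontrivial_iff_two_le.2 (by omega)
      exact exists_ne i
    set e := projH n (indicatorVec {i})
    have he (a b : Fin (n + 1)) :
        e.1 a - e.1 b = (if a = i then 1 else 0) - if b = i then 1 else 0 := by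
      rw [projH_sub]; simp [indicatorVec]
    have hmem (δ : ℝ) (hδ : δ = ε ∨ δ = -ε) : z + δ • e ∈ regionP n := by
      refine mem_regionP_iff.2 fun a b => ?_
      have h5 := he a b
      have h6 := hP a b
      have : (z + δ • e).1 a - (z + δ • e).1 b = z.1 a - z.1 b + δ * (e.1 a - e.1 b) := by
        simp; ring
      rw [this, h5]
      by_cases ha : a = i <;> by_cases hb : b = i
      · simp [ha, hb]
      · rw [ha]
        rcases hδ with rfl | rfl <;> simp only [hb, if_true, if_false] <;> linarith [h1 b hb]
      · rw [hb]
        rcases hδ with rfl | rfl <;> simp only [ha, if_true, if_false] <;> linarith [h2 a ha]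
      · simpa [ha, hb] using h6
    have h0 := hz.2 (hmem ε (Or.inl rfl)) (hmem (-ε) (Or.inr rfl))
      ⟨1 / 2, 1 / 2, by norm_num, by norm_num, by norm_num, by module⟩
    have h7 : ε • e = 0 := by simpa using h0
    rcases smul_eq_zero.1 h7 with h | h
    · exact h
    · have := he i l
      simp [h, hl] at this
  have h01 (i) : z.1 i = z.1 j ∨ z.1 i = z.1 j + 1 := by
    by_contra! hc
    have hi1 : z.1 j < z.1 i := lt_of_le_of_ne (hj i) hc.1.symm
    have hi2 : z.1 i < z.1 j + 1 := lt_of_le_of_ne (by linarith [hP i j]) hc.2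
    have hm := lt_min (sub_pos.2 hi1) (show 0 < z.1 j + 1 - z.1 i by linarith)
    set ε := min (z.1 i - z.1 j) (z.1 j + 1 - z.1 i)
    have ha : ε ≤ z.1 i - z.1 j := min_le_left _ _
    have hb : ε ≤ z.1 j + 1 - z.1 i := min_le_right _ _
    exact hm.ne' (move i ε hm.le (fun k _ => by linarith [hj k]) (fun k _ => by linarith [hP k j]))
  refine ⟨Finset.univ.filter fun i => z.1 i ≠ z.1 j, ?_, fun hu => ?_, ?_⟩
  · by_contra hne
    have hall (i) : z.1 i = z.1 j := by
      by_contra hi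
      exact hne ⟨i, by simpa using hi⟩
    exact one_ne_zero
      (move j 1 zero_le_one (fun k _ => by simp [hall]) (fun k _ => by simp [hall]))
  · simpa using hu.ge (Finset.mem_univ j)
  · refine hyperplaneH_ext_sub j fun i => ?_
    rw [projH_sub]
    rcases h01 i with h | h <;> simp [indicatorVec, h]

lemma verticesP_eq {n : ℕ} (hn : n ≠ 0) : verticesP n = projH n '' cubeV₀ n := by
  ext z
  constructor
  · intro hz
    obtain ⟨J, h1, h2, rfl⟩ := exists_of_mem_extremePoints hn hz
    exact ⟨_, indicatorVec_mem_cubeV₀.2 ⟨h1, h2⟩, rfl⟩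
  · rintro ⟨u, hu, rfl⟩
    obtain ⟨J, rfl⟩ := exists_eq_indicatorVec hu
    obtain ⟨h1, h2⟩ := indicatorVec_mem_cubeV₀.1 hu
    exact projH_mem_extremePoints h1 h2

lemma mem_half_verticesP_iff {n : ℕ} (hn : n ≠ 0) {g : hyperplaneH n} :
    g ∈ (1 / 2 : ℝ) • verticesP n ↔ ∃ J : Finset (Fin (n + 1)),
      J.Nonempty ∧ J ≠ Finset.univ ∧ g = halfVertex J := by
  constructor
  · rintro ⟨z, hz, rfl⟩
    obtain ⟨J, h1, h2, rfl⟩ := exists_of_mem_extremePoints hn hz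
    exact ⟨J, h1, h2, rfl⟩
  · rintro ⟨J, h1, h2, rfl⟩
    exact smul_mem_smul_set (projH_mem_extremePoints h1 h2)

/-- The halves of the vertices `p_H(e_i)` already generate `½ A_n^#`. -/
lemma closure_half_verticesP {n : ℕ} (hn : n ≠ 0) :
    AddSubgroup.closure ((1 / 2 : ℝ) • verticesP n) = halfDual n := by
  refine le_antisymm ((AddSubgroup.closure_le _).2 fun g hg => ?_) fun y hy => ?_
  · obtain ⟨J, -, -, rfl⟩ := (mem_half_verticesP_iff hn).1 hg
    exact halfVertex_mem_halfDual J
  · choose k hk using fun i => mem_halfDual_iff.1 hy i 0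
    -- `y = ∑ 2 (y_i - y_0) · ½ p_H(e_i)`
    have : y = ∑ i, k i • halfVertex {i} := by
      refine hyperplaneH_ext_sub 0 fun i => ?_
      have e (j : Fin (n + 1)) : (∑ i, k i • halfVertex {i} : hyperplaneH n).1 j =
          ∑ i, k i * (halfVertex {i}).1 j := by
        simp [← Int.cast_smul_eq_zsmul ℝ]
      have h0 : (k 0 : ℝ) = 0 := by linarith [hk 0]
      rw [hk, e, e, ← Finset.sum_sub_distrib]
      simp only [← mul_sub, halfVertex_sub]
      simp [mul_sub, Finset.sum_sub_distrib, h0]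
      ring
    rw [this]
    refine sum_mem fun i _ => AddSubgroup.zsmul_mem _ (AddSubgroup.subset_closure ?_) _
    refine (mem_half_verticesP_iff hn).2 ⟨{i}, by simp, fun h => ?_, rfl⟩
    have := congrArg Finset.card h
    simp at this
    omega

/-! ### Pivots of sets avoiding distance one -/

lemma polytopeNorm_halfVertex_sub {n : ℕ} {J K : Finset (Fin (n + 1))} (hJK : ¬J ⊆ K)
    (hKJ : ¬K ⊆ J) : polytopeNorm (regionP n) (halfVertex J - halfVertex K) = 1 := by
  obtain ⟨a, ha, ha'⟩ := Finset.not_subset.1 hJK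
  obtain ⟨b, hb, hb'⟩ := Finset.not_subset.1 hKJ
  refine polytopeNorm_regionP_eq_one_iff.2 ⟨fun i j => ?_, a, b, ?_⟩
  · have h1 := halfVertex_sub_le J i j
    have h2 := halfVertex_sub_le K j i
    simp only [Submodule.coe_sub, PiLp.sub_apply]
    linarith
  · have h1 := halfVertex_sub J a b
    have h2 := halfVertex_sub K a b
    simp only [ha, ha', hb, hb', if_true, if_false] at h1 h2
    simp only [Submodule.coe_sub, PiLp.sub_apply]
    linarith

/-- If `S` avoids distance one, the index sets of the half vertices leading from a given point
into `S` form a chain. -/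
lemma AvoidsOne.subset_or_subset {n : ℕ} {S : Set (hyperplaneH n)}
    (hS : AvoidsOne (polytopeNorm (regionP n)) S) {a b : hyperplaneH n}
    {J K : Finset (Fin (n + 1))} (ha : a ∈ S) (hb : b ∈ S)
    (h : a - b = halfVertex J - halfVertex K) : J ⊆ K ∨ K ⊆ J := by
  by_contra! hc
  exact hS a ha b hb (h ▸ polytopeNorm_halfVertex_sub hc.1 hc.2)

/-- The index `i` is a pivot of `S` at `s` if every half vertex leading from `s` into `S` involves
the index `i`. The translates of `s` by the `2ⁿ` half vertices not involving `i` are the points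
that `s` claims for itself. -/
def IsPivot {n : ℕ} (S : Set (hyperplaneH n)) (i : Fin (n + 1)) (s : hyperplaneH n) : Prop :=
  ∀ J : Finset (Fin (n + 1)), J.Nonempty → s + halfVertex J ∈ S → i ∈ J

/-- Pivots exist: a chain of non-empty sets has a common element. -/
lemma exists_isPivot {n : ℕ} {S : Set (hyperplaneH n)}
    (hS : AvoidsOne (polytopeNorm (regionP n)) S) {s : hyperplaneH n} (hs : s ∈ S) :
    ∃ i, IsPivot S i s := by
  classical
  let F := Finset.univ.filter fun J : Finset (Fin (n + 1)) => J.Nonempty ∧ s + halfVertex J ∈ S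
  have hF : F.Nonempty := ⟨Finset.univ, by simp [F, halfVertex_univ, hs]⟩
  obtain ⟨J, hJ, hmin⟩ := F.exists_min_image Finset.card hF
  obtain ⟨hJ0, hJS⟩ : J.Nonempty ∧ s + halfVertex J ∈ S := by simpa [F] using hJ
  obtain ⟨i, hi⟩ := hJ0
  refine ⟨i, fun K hK0 hKS => ?_⟩
  rcases hS.subset_or_subset hJS hKS (add_sub_add_left_eq_sub _ _ _) with h | h
  · exact h hi
  · rwa [Finset.eq_of_subset_of_card_le h (hmin K (by simp [F, hK0, hKS]))]

/-- The points claimed by different points of a set avoiding distance one are different. -/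
lemma IsPivot.eq_and_eq {n : ℕ} {S : Set (hyperplaneH n)}
    (hS : AvoidsOne (polytopeNorm (regionP n)) S) {a b : hyperplaneH n} (ha : a ∈ S) (hb : b ∈ S)
    {i k : Fin (n + 1)} (hi : IsPivot S i a) (hk : IsPivot S k b) {J K : Finset (Fin (n + 1))}
    (hiJ : i ∉ J) (hkK : k ∉ K) (h : a + halfVertex J = b + halfVertex K) : a = b ∧ J = K := by
  have main {a b : hyperplaneH n} (hb : b ∈ S) {i : Fin (n + 1)} (hi : IsPivot S i a)
      {J K : Finset (Fin (n + 1))} (hiJ : i ∉ J) (h : a + halfVertex J = b + halfVertex K)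
      (hKJ : K ⊆ J) : a = b ∧ J = K := by
    suffices J = K by
      subst this
      exact ⟨add_right_cancel h, rfl⟩
    by_contra hne
    have hb' : b = a + halfVertex (J \ K) := by
      rw [halfVertex_sdiff hKJ, ← add_sub_assoc, h, add_sub_cancel_right]
    have hne' : (J \ K).Nonempty :=
      Finset.sdiff_nonempty.2 fun hJK => hne (hJK.antisymm hKJ)
    exact hiJ (Finset.mem_sdiff.1 (hi _ hne' (hb' ▸ hb))).1
  rcases hS.subset_or_subset ha hb (sub_eq_sub_iff_add_eq_add.2 (h.trans (add_comm _ _)) :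
    a - b = halfVertex K - halfVertex J) with hKJ | hJK
  · exact main hb hi hiJ h hKJ
  · exact (main ha hk hkK h.symm hJK).imp Eq.symm Eq.symm

lemma card_filter_notMem {n : ℕ} (i : Fin (n + 1)) :
    (Finset.univ.filter fun J : Finset (Fin (n + 1)) => i ∉ J).card = 2 ^ n := by
  have : (Finset.univ.filter fun J : Finset (Fin (n + 1)) => i ∉ J) =
      (Finset.univ.erase i).powerset := by
    ext J; simp [Finset.subset_erase]
  rw [this, Finset.card_powerset, Finset.card_erase_of_mem (Finset.mem_univ i)]
  simp

/-! ### The Cayley graph -/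

lemma cayleyG_adj_iff_exists {n : ℕ} (hn : n ≠ 0) {x y : halfDual n} :
    (cayleyG n).Adj x y ↔ ∃ J : Finset (Fin (n + 1)),
      J.Nonempty ∧ J ≠ Finset.univ ∧ (y : hyperplaneH n) = x + halfVertex J := by
  rw [cayleyG, SimpleGraph.addCayley_adj']
  constructor
  · rintro ⟨-, g, hg, h⟩
    obtain ⟨J, h1, h2, h3⟩ := (mem_half_verticesP_iff hn).1 hg
    rcases h with rfl | rfl
    · exact ⟨J, h1, h2, by simp [h3]⟩
    · exact ⟨Jᶜ, Finset.nonempty_iff_ne_empty.2 (by simpa using h2),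
        by simpa using h1.ne_empty, by simp [h3, halfVertex_compl]⟩
  · rintro ⟨J, h1, h2, h⟩
    refine ⟨?_, ⟨halfVertex J, halfVertex_mem_halfDual J⟩,
      (mem_half_verticesP_iff hn).2 ⟨J, h1, h2, rfl⟩, Or.inl (Subtype.ext h.symm)⟩
    rintro rfl
    exact halfVertex_ne_zero h1 h2 (by simpa using h)

/-- Adjacent vertices are those at norm distance `½`. -/
lemma cayleyG_adj_iff {n : ℕ} (hn : n ≠ 0) {x y : halfDual n} :
    (cayleyG n).Adj x y ↔
      x ≠ y ∧ ∀ i j, (y.1 - x.1).1 i - (y.1 - x.1).1 j ≤ 1 / 2 := by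
  constructor
  · intro h
    refine ⟨h.ne, fun i j => ?_⟩
    obtain ⟨J, -, -, hJ⟩ := (cayleyG_adj_iff_exists hn).1 h
    rw [hJ, add_sub_cancel_left]
    exact halfVertex_sub_le J i j
  · rintro ⟨hne, h⟩
    obtain ⟨J, hJu, hJ⟩ := exists_eq_halfVertex (sub_mem y.2 x.2) h
    refine (cayleyG_adj_iff_exists hn).2 ⟨J, ?_, hJu, by rw [← hJ]; abel⟩
    rw [Finset.nonempty_iff_ne_empty]
    rintro rfl
    rw [halfVertex_empty, sub_eq_zero] at hJ
    exact hne (Subtype.ext hJ.symm)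

/-- Property D: two steps of length `½` give norm at most `1`, and norms of points of `½ A_n^#` are
halves of integers, so a norm other than `1` would make the points equal or adjacent. -/
lemma polytopeNorm_eq_one_of_dist_eq_two {n : ℕ} (hn : n ≠ 0) {x y : halfDual n}
    (h : (cayleyG n).dist x y = 2) : polytopeNorm (regionP n) (x.1 - y.1) = 1 := by
  have hne : (cayleyG n).dist x y ≠ 0 := by omega
  obtain ⟨hxy, hr⟩ := SimpleGraph.dist_ne_zero_iff_ne_and_reachable.1 hne
  have hnadj : ¬(cayleyG n).Adj y x := fun hc => by
    have := SimpleGraph.dist_eq_one_iff_adj.2 hc.symm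
    omega
  have he : (cayleyG n).edist x y = 2 := by rw [← hr.coe_dist_eq_edist, h]; rfl
  obtain ⟨-, -, z, hz⟩ := SimpleGraph.edist_eq_two_iff.1 he
  obtain ⟨hxz, hyz⟩ : (cayleyG n).Adj x z ∧ (cayleyG n).Adj y z := hz
  have hle (i j) : (x.1 - y.1).1 i - (x.1 - y.1).1 j ≤ 1 := by
    have h1 := ((cayleyG_adj_iff hn).1 hxz.symm).2 i j
    have h2 := ((cayleyG_adj_iff hn).1 hyz).2 i j
    simp only [Submodule.coe_sub, PiLp.sub_apply] at *
    linarith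
  refine polytopeNorm_regionP_eq_one_iff.2 ⟨hle, ?_⟩
  have hgt : ∃ i j, 1 / 2 < (x.1 - y.1).1 i - (x.1 - y.1).1 j := by
    by_contra! hc
    exact hnadj ((cayleyG_adj_iff hn).2 ⟨hxy.symm, hc⟩)
  obtain ⟨i, j, hij⟩ := hgt
  refine ⟨i, j, ?_⟩
  have hle' := hle i j
  -- the difference is half of an integer and lies in `(½, 1]`
  obtain ⟨k, hk⟩ := mem_halfDual_iff.1 (sub_mem x.2 y.2) i j
  rw [hk] at hij hle' ⊢
  have h1 : (1 : ℝ) < k := by linarith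
  have h2 : (k : ℝ) ≤ 2 := by linarith
  have h1' : 1 < k := by exact_mod_cast h1
  have h2' : k ≤ 2 := by exact_mod_cast h2
  obtain rfl : k = 2 := by omega
  norm_num

/-! ### Cliques -/

lemma sub_le_of_isClique {n : ℕ} (hn : n ≠ 0) {C : Set (halfDual n)}
    (hC : (cayleyG n).IsClique C) {x y : halfDual n} (hx : x ∈ C) (hy : y ∈ C)
    (i j : Fin (n + 1)) : (x.1 - y.1).1 i - (x.1 - y.1).1 j ≤ 1 / 2 := by
  rcases eq_or_ne y x with rfl | hne
  · simp
  · exact ((cayleyG_adj_iff hn).1 (hC hy hx hne)).2 i j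

lemma avoidsOne_of_isClique {n : ℕ} (hn : n ≠ 0) {C : Set (halfDual n)}
    (hC : (cayleyG n).IsClique C) :
    AvoidsOne (polytopeNorm (regionP n)) (((↑) : halfDual n → hyperplaneH n) '' C) := by
  rintro _ ⟨x, hx, rfl⟩ _ ⟨y, hy, rfl⟩ h
  obtain ⟨-, i, j, hij⟩ := polytopeNorm_regionP_eq_one_iff.1 h
  have := sub_le_of_isClique hn hC hx hy i j
  linarith

/-- A clique has at most one point for each possible size of the index set of the half vertex
leading to it from a fixed point of the clique. -/
lemma finite_and_ncard_le_of_isClique {n : ℕ} (hn : n ≠ 0) {C : Set (halfDual n)}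
    (hC : (cayleyG n).IsClique C) : C.Finite ∧ C.ncard ≤ n + 1 := by
  rcases C.eq_empty_or_nonempty with rfl | ⟨c, hc⟩
  · simp
  have hJ (x : C) : ∃ J : Finset (Fin (n + 1)), J ≠ Finset.univ ∧ x.1.1 - c.1 = halfVertex J :=
    exists_eq_halfVertex (sub_mem x.1.2 c.2) (sub_le_of_isClique hn hC x.2 hc)
  choose J hJu hJ using hJ
  have hlt (x : C) : (J x).card < n + 1 := by
    simpa using Finset.card_lt_univ_of_notMem (s := J x)
      (not_forall.1 fun h => hJu x (Finset.eq_univ_iff_forall.2 h)).choose_spec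
  let f : C → Fin (n + 1) := fun x => ⟨(J x).card, hlt x⟩
  have hf : Function.Injective f := by
    intro x y hxy
    have hcard : (J x).card = (J y).card := congrArg Fin.val hxy
    have hsub := (avoidsOne_of_isClique hn hC).subset_or_subset (mem_image_of_mem _ x.2)
      (mem_image_of_mem _ y.2) (show x.1.1 - y.1.1 = halfVertex (J x) - halfVertex (J y) by
        rw [← hJ, ← hJ, sub_sub_sub_cancel_right])
    have heq : J x = J y := by
      rcases hsub with h | h
      · exact Finset.eq_of_subset_of_card_le h hcard.ge
      · exact (Finset.eq_of_subset_of_card_le h hcard.le).symm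
    have := (hJ x).trans (heq ▸ (hJ y).symm)
    exact Subtype.ext (Subtype.ext (sub_left_injective this))
  have hfin : Finite C := Finite.of_injective f hf
  refine ⟨hfin, ?_⟩
  simpa using Nat.card_le_card_of_injective f hf

lemma closedNbhd_finite {n : ℕ} (hn : n ≠ 0) {C : Set (halfDual n)} (hC : C.Finite) :
    (closedNbhd (cayleyG n) C).Finite := by
  let q (J : Finset (Fin (n + 1))) : halfDual n := ⟨halfVertex J, halfVertex_mem_halfDual J⟩
  refine ((hC.add (finite_range q)).subset ?_)
  rintro v ⟨a, ha, rfl | h⟩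
  · exact ⟨v, ha, q ∅, mem_range_self _, Subtype.ext (by simp [q, halfVertex_empty])⟩
  · obtain ⟨J, -, -, hJ⟩ := (cayleyG_adj_iff_exists hn).1 h
    exact ⟨a, ha, q J, mem_range_self _, Subtype.ext hJ.symm⟩

/-- Each point of a clique claims `2ⁿ` points of the closed neighbourhood. -/
lemma localDensity_le {n : ℕ} (hn : n ≠ 0) {C : Set (halfDual n)}
    (hC : (cayleyG n).IsClique C) : localDensity (cayleyG n) C ≤ 1 / 2 ^ n := by
  classical
  have hfin := (finite_and_ncard_le_of_isClique hn hC).1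
  have hN := closedNbhd_finite hn hfin
  have hS := avoidsOne_of_isClique hn hC
  choose i hi using fun x : C => exists_isPivot hS (mem_image_of_mem _ x.2)
  have : Finite C := hfin
  have : Finite (closedNbhd (cayleyG n) C) := hN
  have : Fintype C := Fintype.ofFinite C
  let f : (Σ x : C, Finset.univ.filter fun J : Finset (Fin (n + 1)) => i x ∉ J) →
      closedNbhd (cayleyG n) C := fun p =>
    ⟨⟨p.1.1.1 + halfVertex p.2.1, add_mem p.1.1.2 (halfVertex_mem_halfDual _)⟩, p.1.1, p.1.2, by
      have hp : i p.1 ∉ p.2.1 := (Finset.mem_filter.1 p.2.2).2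
      rcases p.2.1.eq_empty_or_nonempty with h | h
      · exact Or.inl (Subtype.ext (by simp [h, halfVertex_empty]))
      · exact Or.inr ((cayleyG_adj_iff_exists hn).2
          ⟨p.2.1, h, fun hu => hp (hu ▸ Finset.mem_univ _), rfl⟩)⟩
  have hf : Function.Injective f := by
    rintro ⟨x, J, hJ⟩ ⟨y, K, hK⟩ h
    have h' : x.1.1 + halfVertex J = y.1.1 + halfVertex K :=
      congrArg (fun z : closedNbhd (cayleyG n) C => z.1.1) h
    obtain ⟨h1, h2⟩ := (hi x).eq_and_eq hS (mem_image_of_mem _ x.2) (mem_image_of_mem _ y.2)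
      (hi y) (Finset.mem_filter.1 hJ).2 (Finset.mem_filter.1 hK).2 h'
    obtain rfl : x = y := Subtype.ext (Subtype.ext h1)
    subst h2
    rfl
  have hcard : C.ncard * 2 ^ n ≤ (closedNbhd (cayleyG n) C).ncard := by
    have := Nat.card_le_card_of_injective f hf
    have hc (x : C) : Nat.card (Finset.univ.filter fun J : Finset (Fin (n + 1)) => i x ∉ J) =
        2 ^ n := by
      rw [Nat.card_eq_fintype_card, Fintype.card_coe, card_filter_notMem]
    simp only [Nat.card_sigma, hc, Finset.sum_const, smul_eq_mul, Finset.card_univ] at this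
    rwa [← Nat.card_eq_fintype_card, Nat.card_coe_set_eq, Nat.card_coe_set_eq] at this
  rw [localDensity]
  have hcard' : (C.ncard : ℝ) * 2 ^ n ≤ (closedNbhd (cayleyG n) C).ncard := by exact_mod_cast hcard
  rcases (Nat.zero_le (closedNbhd (cayleyG n) C).ncard).eq_or_lt with h0 | h0
  · rw [← h0]; simp
  · rw [div_le_div_iff₀ (by exact_mod_cast h0) (by positivity), one_mul]
    exact hcard'

/-- A finite chain can be listed increasingly. -/
lemma exists_strictMono_of_isChain {α : Type*} (D : Finset (Finset α))
    (hD : ∀ J ∈ D, ∀ K ∈ D, J ⊆ K ∨ K ⊆ J) :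
    ∃ (s : ℕ) (f : Fin s → Finset α), StrictMono f ∧ range f = D := by
  classical
  let T := D.image Finset.card
  have hex (i : Fin T.card) : ∃ J ∈ D, J.card = T.orderEmbOfFin rfl i :=
    Finset.mem_image.1 (T.orderEmbOfFin_mem rfl i)
  choose f hfD hf using hex
  have heq {J K : Finset α} (hJ : J ∈ D) (hK : K ∈ D) (h : J.card = K.card) : J = K := by
    rcases hD J hJ K hK with h' | h'
    · exact Finset.eq_of_subset_of_card_le h' h.ge
    · exact (Finset.eq_of_subset_of_card_le h' h.le).symm
  refine ⟨T.card, f, fun i j hij => ?_, ?_⟩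
  · have hlt : (f i).card < (f j).card := by
      rw [hf, hf]; exact (T.orderEmbOfFin rfl).strictMono hij
    rcases hD _ (hfD i) _ (hfD j) with h | h
    · exact lt_of_le_of_ne h fun h => hlt.ne (congrArg _ h)
    · exact absurd (Finset.card_le_card h) hlt.not_ge
  · refine Subset.antisymm (range_subset_iff.2 hfD) fun J hJ => ?_
    have hT : J.card ∈ range (T.orderEmbOfFin rfl) := by
      rw [Finset.range_orderEmbOfFin]
      exact Finset.mem_image_of_mem _ hJ
    obtain ⟨i, hi⟩ := hT
    exact ⟨i, heq (hfD i) hJ ((hf i).trans hi)⟩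

/-- Two half vertices `½ p_H(1_J)` and `½ p_H(1_K)` are at norm distance at most `½` exactly when
`J` and `K` are comparable. -/
lemma isClique_iff_exists_chain {n : ℕ} (hn : n ≠ 0) {C : Set (halfDual n)} (h0 : 0 ∈ C) :
    (cayleyG n).IsClique C ↔
      ∃ (s : ℕ) (u : Fin s → EuclideanSpace ℝ (Fin (n + 1))),
        (∀ i, u i ∈ cubeV₀ n) ∧
        StrictMono (fun i => cubeSupport (u i)) ∧
        ((↑) : halfDual n → hyperplaneH n) '' C =
          insert 0 (Set.range fun i => (1 / 2 : ℝ) • projH n (u i)) := by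
  classical
  constructor
  · intro hC
    let D := Finset.univ.filter fun J : Finset (Fin (n + 1)) => J.Nonempty ∧ J ≠ Finset.univ ∧
      halfVertex J ∈ ((↑) : halfDual n → hyperplaneH n) '' C
    have hD (J) : J ∈ D ↔ J.Nonempty ∧ J ≠ Finset.univ ∧
        halfVertex J ∈ ((↑) : halfDual n → hyperplaneH n) '' C := by
      simp only [D, Finset.mem_filter_univ]
    obtain ⟨s, f, hf, hfD⟩ := exists_strictMono_of_isChain D fun J hJ K hK =>
      (avoidsOne_of_isClique hn hC).subset_or_subset ((hD J).1 hJ).2.2 ((hD K).1 hK).2.2 rfl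
    have hfD' (i) : f i ∈ D := by
      have := mem_range_self (f := f) i
      rwa [hfD] at this
    refine ⟨s, fun i => indicatorVec (f i), fun i => ?_, fun i j hij => ?_, ?_⟩
    · obtain ⟨h1, h2, -⟩ := (hD _).1 (hfD' i)
      exact indicatorVec_mem_cubeV₀.2 ⟨h1, h2⟩
    · simpa only [cubeSupport_indicatorVec] using Finset.coe_ssubset.2 (hf hij)
    · ext x
      constructor
      · rintro ⟨c, hc, rfl⟩
        rcases eq_or_ne 0 c with rfl | hne
        · exact Or.inl rfl
        · obtain ⟨J, h1, h2, h3⟩ := (cayleyG_adj_iff_exists hn).1 (hC h0 hc hne)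
          have h3' : c.1 = halfVertex J := by simpa using h3
          have : J ∈ range f := by
            rw [hfD]
            exact (hD J).2 ⟨h1, h2, h3' ▸ mem_image_of_mem _ hc⟩
          obtain ⟨i, rfl⟩ := this
          exact Or.inr ⟨i, h3'.symm⟩
      · rintro (rfl | ⟨i, rfl⟩)
        · exact ⟨0, h0, rfl⟩
        · exact ((hD _).1 (hfD' i)).2.2
  · rintro ⟨s, u, hu, hmono, hCu⟩
    choose J hJ using fun i => exists_eq_indicatorVec (hu i)
    have hJ0 (i j) (hij : i ≤ j) : J i ⊆ J j := by
      have := hmono.monotone hij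
      simpa only [hJ, cubeSupport_indicatorVec, Finset.coe_subset] using this
    have hrep (c : C) : ∃ K, (c : hyperplaneH n) = halfVertex K ∧ (K = ∅ ∨ ∃ i, K = J i) := by
      have : (c : hyperplaneH n) ∈ ((↑) : halfDual n → hyperplaneH n) '' C :=
        mem_image_of_mem _ c.2
      rw [hCu] at this
      rcases this with h | ⟨i, h⟩
      · exact ⟨∅, by rw [h, halfVertex_empty], Or.inl rfl⟩
      · exact ⟨J i, by rw [← h, halfVertex, ← hJ], Or.inr ⟨i, rfl⟩⟩
    intro x hx y hy hne
    obtain ⟨K, hK, hK'⟩ := hrep ⟨x, hx⟩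
    obtain ⟨L, hL, hL'⟩ := hrep ⟨y, hy⟩
    have hKL : K ⊆ L ∨ L ⊆ K := by
      rcases hK' with rfl | ⟨i, rfl⟩
      · exact Or.inl (Finset.empty_subset _)
      rcases hL' with rfl | ⟨j, rfl⟩
      · exact Or.inr (Finset.empty_subset _)
      exact (le_total i j).imp (hJ0 i j) (hJ0 j i)
    rcases hKL with h | h
    · refine (cayleyG_adj_iff hn).2 ⟨hne, fun i j => ?_⟩
      rw [hK, hL, ← halfVertex_sdiff h]
      exact halfVertex_sub_le _ i j
    · refine ((cayleyG_adj_iff hn).2 ⟨hne.symm, fun i j => ?_⟩).symm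
      rw [hK, hL, ← halfVertex_sdiff h]
      exact halfVertex_sub_le _ i j

/-! ### Growing cubes -/

lemma add_mem_Icc_of_norm_le {n : ℕ} {x v : Fin n → ℝ} {R c : ℝ}
    (hx : x ∈ Icc (fun _ => -R) fun _ => R) (hv : ‖v‖ ≤ c) :
    x + v ∈ Icc (fun _ => -(R + c)) fun _ => R + c := by
  have h (i) : |v i| ≤ c := (norm_le_pi_norm v i).trans hv
  exact ⟨fun i => by have := hx.1 i; have := (abs_le.1 (h i)).1; simp; linarith,
    fun i => by have := hx.2 i; have := (abs_le.1 (h i)).2; simp; linarith⟩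

lemma volume_cube {n : ℕ} (R : ℝ) :
    volume (Icc (fun _ => -R) (fun _ => R) : Set (Fin n → ℝ)) = ENNReal.ofReal (2 * R) ^ n := by
  rw [Real.volume_Icc_pi]
  simp [two_mul]

lemma tendsto_volume_cube_div {n : ℕ} (c : ℝ) :
    Tendsto (fun R : ℝ => volume (Icc (fun _ => -(R + c)) (fun _ => R + c) : Set (Fin n → ℝ)) /
      volume (Icc (fun _ => -R) (fun _ => R) : Set (Fin n → ℝ))) atTop (nhds 1) := by
  have h1 : Tendsto (fun R : ℝ => (1 + c * R⁻¹) ^ n) atTop (nhds 1) := by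
    simpa using ((tendsto_inv_atTop_zero.const_mul c).const_add 1).pow n
  have h2 := ENNReal.tendsto_ofReal h1
  rw [ENNReal.ofReal_one] at h2
  refine h2.congr' ?_
  filter_upwards [eventually_gt_atTop 0, eventually_ge_atTop (-c)] with R hR hRc
  have h3 : 0 ≤ R + c := by linarith
  rw [volume_cube, volume_cube, ← ENNReal.ofReal_pow (by positivity),
    ← ENNReal.ofReal_pow (by positivity), ← ENNReal.ofReal_div_of_pos (by positivity), ← div_pow]
  congr 2
  field_simp

/-! ### The upper bound for the density -/

lemma polytopeNorm_preimage {E F : Type*} [AddCommGroup E] [Module ℝ E] [AddCommGroup F]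
    [Module ℝ F] (φ : E ≃ₗ[ℝ] F) (P : Set F) (x : E) :
    polytopeNorm (φ ⁻¹' P) x = polytopeNorm P (φ x) := by
  simp [polytopeNorm, gauge_def']

/-- A set avoiding distance one has `2ⁿ` disjoint copies in a neighbourhood: each point is moved to
the `2ⁿ` points that it claims. -/
lemma two_pow_mul_volume_le {n : ℕ} (φ : (Fin n → ℝ) ≃ₗ[ℝ] hyperplaneH n) {T : Set (Fin n → ℝ)}
    (hTm : MeasurableSet T) (hT : AvoidsOne (polytopeNorm (regionP n)) (φ '' T)) {c : ℝ}
    (hc : ∀ J : Finset (Fin (n + 1)), ‖φ.symm (halfVertex J)‖ ≤ c) (R : ℝ) :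
    2 ^ n * volume (T ∩ Icc (fun _ => -R) fun _ => R) ≤
      volume (Icc (fun _ => -(R + c)) (fun _ => R + c) : Set (Fin n → ℝ)) := by
  classical
  set B : Set (Fin n → ℝ) := Icc (fun _ => -R) fun _ => R
  let G (i : Fin (n + 1)) : Set (Fin n → ℝ) := {t | t ∈ T ∧ IsPivot (φ '' T) i (φ t)}
  have hmem (t : Fin n → ℝ) (J : Finset (Fin (n + 1))) :
      φ t + halfVertex J ∈ φ '' T ↔ t + φ.symm (halfVertex J) ∈ T := by
    rw [← φ.injective.mem_set_image (s := T), map_add, φ.apply_symm_apply]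
  have hG (i) : MeasurableSet (G i) := by
    have : G i = T ∩ ⋂ J : Finset (Fin (n + 1)), ⋂ (_ : J.Nonempty), ⋂ (_ : i ∉ J),
        {t | t + φ.symm (halfVertex J) ∈ T}ᶜ := by
      ext t
      simp only [G, IsPivot, hmem, mem_ofPred_eq, mem_inter_iff, mem_iInter, mem_compl_iff]
      exact and_congr_right fun _ => forall₂_congr fun J _ =>
        ⟨fun h => mt h, fun h => not_imp_not.1 h⟩
    rw [this]
    exact hTm.inter (.iInter fun J => .iInter fun _ => .iInter fun _ =>
      (measurable_add_const (φ.symm (halfVertex J)) hTm).compl)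
  let P := disjointed G
  have hPG (i) : P i ⊆ G i := disjointed_subset G i
  have hP (i) : MeasurableSet (P i) := by
    rw [show P i = _ from disjointed_eq_inter_compl G i]
    exact (hG i).inter (.iInter fun j => .iInter fun _ => (hG j).compl)
  have hPd : Pairwise (Function.onFun Disjoint P) := disjoint_disjointed G
  have hPU : ⋃ i, P i = T := by
    rw [show ⋃ i, P i = _ from iUnion_disjointed]
    refine Subset.antisymm (iUnion_subset fun i t ht => ht.1) fun t ht => mem_iUnion.2 ?_
    exact (exists_isPivot hT (mem_image_of_mem φ ht)).imp fun i hi => ⟨ht, hi⟩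
  let W (p : Σ i : Fin (n + 1), Finset.univ.filter fun J : Finset (Fin (n + 1)) => i ∉ J) :
      Set (Fin n → ℝ) := (· + -φ.symm (halfVertex p.2.1)) ⁻¹' (P p.1 ∩ B)
  have hW (p) : MeasurableSet (W p) :=
    measurable_add_const _ ((hP p.1).inter measurableSet_Icc)
  have hWd : Pairwise (Function.onFun Disjoint W) := by
    rintro ⟨i, J, hJ⟩ ⟨k, K, hK⟩ hne
    refine Set.disjoint_left.2 fun x hx hy => hne ?_
    have hx1 : x + -φ.symm (halfVertex J) ∈ P i := hx.1
    have hy1 : x + -φ.symm (halfVertex K) ∈ P k := hy.1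
    obtain ⟨hxT, hxi⟩ := hPG i hx1
    obtain ⟨hyT, hyk⟩ := hPG k hy1
    obtain ⟨h1, rfl⟩ := hxi.eq_and_eq hT (mem_image_of_mem φ hxT) (mem_image_of_mem φ hyT) hyk
      (Finset.mem_filter.1 hJ).2 (Finset.mem_filter.1 hK).2 (by simp)
    obtain rfl : i = k := by
      by_contra hik
      exact Set.disjoint_left.1 (hPd hik) hx1 hy1
    rfl
  have hWB : ⋃ p, W p ⊆ Icc (fun _ => -(R + c)) fun _ => R + c := by
    refine iUnion_subset fun p x hx => ?_
    simpa using add_mem_Icc_of_norm_le hx.2 (hc p.2.1)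
  calc 2 ^ n * volume (T ∩ B)
      = 2 ^ n * ∑ i, volume (P i ∩ B) := by
        rw [← hPU, iUnion_inter, measure_iUnion, tsum_fintype]
        · exact fun i j hij => (hPd hij).mono inter_subset_left inter_subset_left
        · exact fun i => (hP i).inter measurableSet_Icc
    _ = ∑ p, volume (W p) := by
        simp only [W, measure_preimage_add_right, Fintype.sum_sigma, Finset.sum_const,
          Finset.card_univ, Fintype.card_coe, card_filter_notMem, nsmul_eq_mul, Finset.mul_sum]
        push_cast
        rfl
    _ = volume (⋃ p, W p) := by rw [measure_iUnion hWd hW, tsum_fintype]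
    _ ≤ _ := measure_mono hWB

lemma exists_norm_le {ι E : Type*} [Finite ι] [SeminormedAddGroup E] (f : ι → E) :
    ∃ c, ∀ i, ‖f i‖ ≤ c := by
  obtain ⟨c, hc⟩ := (finite_range fun i => ‖f i‖).bddAbove
  exact ⟨c, fun i => hc (mem_range_self i)⟩

/-- The neighbourhood of the cube containing the `2ⁿ` disjoint copies has asymptotically the volume
of the cube itself. -/
lemma upperDensity_le {n : ℕ} (φ : (Fin n → ℝ) ≃ₗ[ℝ] hyperplaneH n) {S : Set (Fin n → ℝ)}
    (hSm : NullMeasurableSet S volume) (hS : AvoidsOne (polytopeNorm (φ ⁻¹' regionP n)) S) :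
    upperDensity S ≤ 1 / 2 ^ n := by
  obtain ⟨T, hTS, hTm, hTae⟩ := hSm.exists_measurable_subset_ae_eq
  have hT : AvoidsOne (polytopeNorm (regionP n)) (φ '' T) := by
    rintro _ ⟨x, hx, rfl⟩ _ ⟨y, hy, rfl⟩
    rw [← map_sub, ← polytopeNorm_preimage]
    exact hS x (hTS hx) y (hTS hy)
  obtain ⟨c, hc⟩ := exists_norm_le fun J : Finset (Fin (n + 1)) => φ.symm (halfVertex J)
  have hlim := ENNReal.Tendsto.const_mul (a := 1 / 2 ^ n) (tendsto_volume_cube_div (n := n) c)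
    (Or.inl one_ne_zero)
  rw [mul_one] at hlim
  rw [upperDensity, ← hlim.limsup_eq]
  refine limsup_le_limsup (Eventually.of_forall fun R => ?_)
  beta_reduce
  have hST : volume (S ∩ Icc (fun _ => -R) fun _ => R) =
      volume (T ∩ Icc (fun _ => -R) fun _ => R) :=
    measure_congr (ae_eq_set_inter hTae.symm Filter.EventuallyEq.rfl)
  rw [hST, ← mul_div_assoc]
  refine ENNReal.div_le_div_right ?_ _
  have h2 : (2 : ℝ≥0∞) ^ n ≠ 0 := by simp
  have h2' : (2 : ℝ≥0∞) ^ n ≠ ∞ := by simp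
  rw [one_div, mul_comm, ← div_eq_mul_inv,
    ENNReal.le_div_iff_mul_le (Or.inl h2) (Or.inl h2'), mul_comm]
  exact two_pow_mul_volume_le φ hTm hT hc R

/-! ### A set of density `1 / 2ⁿ` -/

/-- For every `m`, the indices of the `m` largest values of an injective function. -/
lemma exists_finset_card_eq_upward_closed {ι α : Type*} [Fintype ι] [LinearOrder α] (g : ι → α)
    (hg : Function.Injective g) {m : ℕ} (hm : m ≤ Fintype.card ι) :
    ∃ T : Finset ι, T.card = m ∧ ∀ i ∉ T, ∀ j ∈ T, g i < g j := by
  classical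
  induction m with
  | zero => exact ⟨∅, by simp⟩
  | succ m ih =>
    obtain ⟨T, hT, h⟩ := ih (by omega)
    have hne : Tᶜ.Nonempty := by
      rw [← Finset.card_pos, Finset.card_compl]; omega
    obtain ⟨a, ha, hmax⟩ := Tᶜ.exists_max_image g hne
    have haT : a ∉ T := Finset.mem_compl.1 ha
    refine ⟨insert a T, by rw [Finset.card_insert_of_notMem haT, hT], fun i hi j hj => ?_⟩
    rw [Finset.mem_insert, not_or] at hi
    rcases Finset.mem_insert.1 hj with rfl | hj
    · exact lt_of_le_of_ne (hmax i (Finset.mem_compl.2 hi.2)) fun h => hi.1 (hg h)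
    · exact h i hi.2 j hj

/-- Rounding: a vector with sum `0` differs from an integer vector with sum `0` by a vector of
spread at most `1`. The strict inequalities express that the spread is `1` only in one of the two
possible directions for each pair of coordinates. -/
lemma exists_int_sum_eq_zero_sub_le {n : ℕ} (x : Fin (n + 1) → ℝ) (hx : ∑ i, x i = 0) :
    ∃ k : Fin (n + 1) → ℤ, ∑ i, k i = 0 ∧
      ∀ i j, (x i - k i) - (x j - k j) ≤ 1 ∧ (i < j → (x i - k i) - (x j - k j) < 1) := by
  classical
  have hfl : ∑ i, Int.fract (x i) = -∑ i, (⌊x i⌋ : ℝ) := by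
    simp only [← Int.self_sub_floor, Finset.sum_sub_distrib, hx, zero_sub]
  have h0 : 0 ≤ -∑ i, ⌊x i⌋ := by
    have : (0 : ℝ) ≤ -∑ i, (⌊x i⌋ : ℝ) := hfl ▸ Finset.sum_nonneg fun i _ => Int.fract_nonneg _
    exact_mod_cast this
  obtain ⟨m, hm⟩ := Int.eq_ofNat_of_zero_le h0
  have hmle : m ≤ Fintype.card (Fin (n + 1)) := by
    have h1 : ∑ i, Int.fract (x i) ≤ ∑ i : Fin (n + 1), (1 : ℝ) :=
      Finset.sum_le_sum fun i _ => (Int.fract_lt_one _).le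
    rw [hfl] at h1
    have h2 : -∑ i, (⌊x i⌋ : ℝ) = (m : ℝ) := by exact_mod_cast congrArg (Int.cast (R := ℝ)) hm
    rw [h2] at h1
    simp only [Finset.sum_const, Finset.card_univ, nsmul_eq_mul, mul_one] at h1
    exact_mod_cast h1
  -- round up the `m` coordinates with the largest fractional parts, smaller indices first
  obtain ⟨T, hT, hlt⟩ := exists_finset_card_eq_upward_closed
    (fun i => toLex (Int.fract (x i), OrderDual.toDual i))
    (fun i j h => by simpa using congrArg (fun p => (ofLex p).2) h) hmle
  refine ⟨fun i => ⌊x i⌋ + if i ∈ T then 1 else 0, ?_, fun i j => ?_⟩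
  · rw [Finset.sum_add_distrib, Finset.sum_boole, Finset.filter_univ_mem, hT]
    linarith [show -∑ i, ⌊x i⌋ = (m : ℤ) from hm]
  · have hi0 := Int.fract_nonneg (x i)
    have hi1 := Int.fract_lt_one (x i)
    have hj0 := Int.fract_nonneg (x j)
    have hj1 := Int.fract_lt_one (x j)
    have hi2 := Int.self_sub_floor (x i)
    have hj2 := Int.self_sub_floor (x j)
    push_cast
    by_cases hi : i ∈ T <;> by_cases hj : j ∈ T <;> simp only [hi, hj, if_true, if_false]
    · exact ⟨by linarith, fun _ => by linarith⟩
    · exact ⟨by linarith, fun _ => by linarith⟩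
    · rcases Prod.Lex.toLex_lt_toLex.1 (hlt i hi j hj) with h | ⟨h, h'⟩
      · change Int.fract (x i) < Int.fract (x j) at h
        exact ⟨by linarith, fun _ => by linarith⟩
      · change Int.fract (x i) = Int.fract (x j) at h
        exact ⟨by linarith, fun hij => absurd (OrderDual.toDual_lt_toDual.1 h') hij.not_gt⟩
    · exact ⟨by linarith, fun _ => by linarith⟩

/-- The union of the translates by `A_n` of a half-open version of `½ P`. In the half-open region
the spread `z_i - z_j = ½` is allowed for `i > j` only, so that differences of its points have norm
less than one. -/
def tileSet (n : ℕ) : Set (hyperplaneH n) :=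
  {z | ∃ k : Fin (n + 1) → ℤ, ∑ i, k i = 0 ∧ ∀ i j,
    (z.1 i - k i) - (z.1 j - k j) ≤ 1 / 2 ∧ (i < j → (z.1 i - k i) - (z.1 j - k j) < 1 / 2)}

lemma avoidsOne_tileSet (n : ℕ) : AvoidsOne (polytopeNorm (regionP n)) (tileSet n) := by
  rintro x ⟨k, hk0, hk⟩ y ⟨l, hl0, hl⟩ h
  obtain ⟨hle, a, b, hab⟩ := polytopeNorm_regionP_eq_one_iff.1 h
  simp only [Submodule.coe_sub, PiLp.sub_apply] at hle hab
  have hlt (i j) (hij : i ≠ j) :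
      (x.1 i - k i) - (x.1 j - k j) - ((y.1 i - l i) - (y.1 j - l j)) < 1 := by
    rcases hij.lt_or_gt with h | h
    · linarith [(hk i j).2 h, (hl j i).1]
    · linarith [(hk i j).1, (hl j i).2 h]
  by_cases hkl : ∀ i, k i = l i
  · have hne : a ≠ b := by rintro rfl; simp at hab
    have := hlt a b hne
    rw [hkl a, hkl b] at this
    linarith
  · -- the translation vector `k - l` has a positive and a negative coordinate
    have hs : ∑ i, (k i - l i) = 0 := by rw [Finset.sum_sub_distrib, hk0, hl0, sub_zero]
    have hne : ∃ i ∈ Finset.univ, k i - l i ≠ 0 := by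
      simpa [sub_eq_zero] using hkl
    obtain ⟨i, -, hi⟩ := Finset.exists_pos_of_sum_zero_of_exists_nonzero _ hs hne
    obtain ⟨j, hj⟩ : ∃ j, k j - l j < 0 := by
      by_contra! hc
      have := Finset.sum_pos' (fun j _ => hc j) ⟨i, Finset.mem_univ i, hi⟩
      omega
    have hij : j ≠ i := by rintro rfl; omega
    have h1 := hlt j i hij
    have h2 := hle i j
    have h3 : (1 : ℝ) ≤ k i - l i := by exact_mod_cast hi
    have h4 : (k j - l j : ℝ) ≤ -1 := by
      have : k j - l j ≤ -1 := by omega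
      exact_mod_cast this
    linarith

/-- Representatives of `½ A_n` modulo `A_n`: the sums of `½ (e_i - e_0)` over subsets of the
indices `i > 0`. -/
noncomputable def halfShift {n : ℕ} (J : Finset (Fin n)) : hyperplaneH n :=
  ⟨WithLp.toLp 2 (Fin.cons (-(J.card / 2)) fun i => if i ∈ J then 1 / 2 else 0), by
    change ∑ i, _ = (0 : ℝ)
    rw [Fin.sum_univ_succ]
    simp [div_eq_mul_inv]⟩

/-- Since `½ P` tiles along `½ A_n`, the space is covered by `2ⁿ` translates of `tileSet n`. -/
lemma exists_sub_halfShift_mem_tileSet {n : ℕ} (z : hyperplaneH n) :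
    ∃ J : Finset (Fin n), z - halfShift J ∈ tileSet n := by
  classical
  have hz : ∑ i, z.1 i = 0 := z.2
  obtain ⟨k, hk0, hk⟩ := exists_int_sum_eq_zero_sub_le (fun i => 2 * z.1 i)
    (by rw [← Finset.mul_sum, hz, mul_zero])
  let J : Finset (Fin n) := Finset.univ.filter fun i => k i.succ % 2 = 1
  have hsucc (i : Fin n) : (halfShift J).1 i.succ = if i ∈ J then 1 / 2 else 0 := rfl
  have hJs : (halfShift J).1 0 = -((J.card : ℝ) / 2) := rfl
  let l (i : Fin n) : ℤ := k i.succ / 2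
  have hl (i : Fin n) : k i.succ = 2 * l i + if i ∈ J then 1 else 0 := by
    simp only [l, J, Finset.mem_filter_univ]
    split_ifs <;> omega
  have hl' (i : Fin (n + 1)) :
      (k i : ℝ) / 2 = (Fin.cons (-∑ i, l i) l : Fin (n + 1) → ℤ) i + (halfShift J).1 i := by
    refine Fin.cases ?_ (fun i => ?_) i
    · have h0 : k 0 = -∑ i : Fin n, k i.succ := by
        rw [Fin.sum_univ_succ] at hk0; omega
      have h1 : ∑ i : Fin n, k i.succ = 2 * ∑ i, l i + J.card := by
        simp only [hl, Finset.sum_add_distrib, ← Finset.mul_sum, Finset.sum_boole,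
          Finset.filter_univ_mem]
      rw [h0, h1, hJs, Fin.cons_zero]
      push_cast
      ring
    · rw [hl, hsucc, Fin.cons_succ]
      push_cast
      split_ifs <;> ring
  refine ⟨J, Fin.cons (-∑ i, l i) l, by simp [Fin.sum_univ_succ], fun i j => ?_⟩
  obtain ⟨h1, h2⟩ := hk i j
  have hi := hl' i
  have hj := hl' j
  simp only [Submodule.coe_sub, PiLp.sub_apply]
  exact ⟨by linarith, fun hij => by linarith [h2 hij]⟩

lemma measurableSet_preimage_tileSet {n : ℕ} (φ : (Fin n → ℝ) ≃ₗ[ℝ] hyperplaneH n) :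
    MeasurableSet (φ ⁻¹' tileSet n) := by
  have hφ : Continuous φ := φ.toLinearMap.continuous_of_finiteDimensional
  have hc (i : Fin (n + 1)) : Measurable fun x => (φ x).1 i :=
    ((EuclideanSpace.proj i).continuous.comp (continuous_subtype_val.comp hφ)).measurable
  have : φ ⁻¹' tileSet n = ⋃ k : Fin (n + 1) → ℤ, ⋃ (_ : ∑ i, k i = 0), ⋂ i, ⋂ j,
      {x | ((φ x).1 i - k i) - ((φ x).1 j - k j) ≤ 1 / 2} ∩
        ⋂ (_ : i < j), {x | ((φ x).1 i - k i) - ((φ x).1 j - k j) < 1 / 2} := by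
    ext x
    simp [tileSet]
  rw [this]
  have hd (k : Fin (n + 1) → ℤ) (i j : Fin (n + 1)) :
      Measurable fun x => ((φ x).1 i - k i) - ((φ x).1 j - k j) :=
    ((hc i).sub_const _).sub ((hc j).sub_const _)
  exact .iUnion fun k => .iUnion fun _ => .iInter fun i => .iInter fun j =>
    (measurableSet_le (hd k i j) measurable_const).inter
      (.iInter fun _ => measurableSet_lt (hd k i j) measurable_const)

/-- The covering by `2ⁿ` translates bounds the volume of a cube. -/
lemma volume_cube_le {n : ℕ} (φ : (Fin n → ℝ) ≃ₗ[ℝ] hyperplaneH n) {c : ℝ}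
    (hc : ∀ J : Finset (Fin n), ‖-φ.symm (halfShift J)‖ ≤ c) (R : ℝ) :
    volume (Icc (fun _ => -(R + -c)) (fun _ => R + -c) : Set (Fin n → ℝ)) ≤
      2 ^ n * volume (φ ⁻¹' tileSet n ∩ Icc (fun _ => -R) fun _ => R) := by
  set A := φ ⁻¹' tileSet n ∩ Icc (fun _ => -R) fun _ => R
  calc _ ≤ volume (⋃ J : Finset (Fin n), (· + -φ.symm (halfShift J)) ⁻¹' A) := by
        refine measure_mono fun x hx => ?_
        obtain ⟨J, hJ⟩ := exists_sub_halfShift_mem_tileSet (φ x)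
        refine mem_iUnion.2 ⟨J, ?_, ?_⟩
        · simpa [sub_eq_add_neg] using hJ
        · simpa using add_mem_Icc_of_norm_le hx (hc J)
    _ ≤ ∑ J : Finset (Fin n), volume ((· + -φ.symm (halfShift J)) ⁻¹' A) :=
        measure_iUnion_fintype_le _ _
    _ = _ := by simp [measure_preimage_add_right]

lemma le_upperDensity_tileSet {n : ℕ} (φ : (Fin n → ℝ) ≃ₗ[ℝ] hyperplaneH n) :
    1 / 2 ^ n ≤ upperDensity (φ ⁻¹' tileSet n) := by
  obtain ⟨c, hc⟩ := exists_norm_le fun J : Finset (Fin n) => -φ.symm (halfShift J)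
  have hlim := ENNReal.Tendsto.const_mul (a := 1 / 2 ^ n) (tendsto_volume_cube_div (n := n) (-c))
    (Or.inl one_ne_zero)
  rw [mul_one] at hlim
  rw [upperDensity, ← hlim.limsup_eq]
  refine limsup_le_limsup (Eventually.of_forall fun R => ?_)
  beta_reduce
  rw [← mul_div_assoc]
  refine ENNReal.div_le_div_right ?_ _
  have h2 : (2 : ℝ≥0∞) ^ n ≠ 0 := by simp
  have h2' : (2 : ℝ≥0∞) ^ n ≠ ∞ := by simp
  rw [one_div, mul_comm, ← div_eq_mul_inv, ENNReal.div_le_iff h2 h2', mul_comm]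
  exact volume_cube_le φ hc R

/-! ### The value of `m₁` and the properties of the Cayley graph -/

lemma mOne_eq {n : ℕ} (φ : (Fin n → ℝ) ≃ₗ[ℝ] hyperplaneH n) :
    mOne (polytopeNorm (φ ⁻¹' regionP n)) = 1 / 2 ^ n := by
  refine le_antisymm (iSup_le fun S => iSup₂_le fun hSm hS => upperDensity_le φ hSm hS) ?_
  refine le_iSup_of_le (φ ⁻¹' tileSet n) (le_iSup₂_of_le
    (measurableSet_preimage_tileSet φ).nullMeasurableSet (fun x hx y hy => ?_)
    (le_upperDensity_tileSet φ))
  rw [polytopeNorm_preimage, map_sub]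
  exact avoidsOne_tileSet n _ hx _ hy

theorem mainTheorem2 (n : ℕ) (hn : 2 ≤ n) :
    -- `m₁(ℝⁿ, ‖·‖_P) = 1 / 2ⁿ`, for every linear identification `φ` of `ℝⁿ` with `H`
    (∀ φ : (Fin n → ℝ) ≃ₗ[ℝ] hyperplaneH n,
      mOne (polytopeNorm (φ ⁻¹' regionP n)) = 1 / 2 ^ n) ∧
    -- the vertices of `P`, and the group generated by their halves
    verticesP n = projH n '' cubeV₀ n ∧
    AddSubgroup.closure ((1 / 2 : ℝ) • verticesP n) = halfDual n ∧
    -- Property D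
    (∀ x y : halfDual n, (cayleyG n).dist x y = 2 →
      polytopeNorm (regionP n) ((x : hyperplaneH n) - (y : hyperplaneH n)) = 1) ∧
    -- the cliques containing `0` are given by the chains of supports
    (∀ C : Set (halfDual n), 0 ∈ C →
      ((cayleyG n).IsClique C ↔
        ∃ (s : ℕ) (u : Fin s → EuclideanSpace ℝ (Fin (n + 1))),
          (∀ i, u i ∈ cubeV₀ n) ∧
          StrictMono (fun i => cubeSupport (u i)) ∧
          ((↑) : halfDual n → hyperplaneH n) '' C =
            insert 0 (Set.range fun i => (1 / 2 : ℝ) • projH n (u i)))) ∧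
    -- every clique has at most `n + 1` vertices and local density at most `1 / 2ⁿ`
    (∀ C : Set (halfDual n), (cayleyG n).IsClique C →
      C.Finite ∧ C.ncard ≤ n + 1 ∧ (closedNbhd (cayleyG n) C).Finite ∧
        localDensity (cayleyG n) C ≤ 1 / 2 ^ n) := by
  have hn0 : n ≠ 0 := by omega
  refine ⟨mOne_eq, verticesP_eq hn0, closure_half_verticesP hn0,
    fun x y => polytopeNorm_eq_one_of_dist_eq_two hn0,
    fun C h0 => isClique_iff_exists_chain hn0 h0, fun C hC => ?_⟩
  obtain ⟨h1, h2⟩ := finite_and_ncard_le_of_isClique hn0 hC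
  exact ⟨h1, h2, closedNbhd_finite hn0 h1, localDensity_le hn0 hC⟩
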